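/- Let $(R,\mathfrak m)$ be a one-dimensional Noetherian local domain with infinite residue field and quotient field $K$. Assume that the integral closure $\overline R$ of $R$ in $K$ is a finite $R$-module and a discrete valuation ring (so $R$ is analytically irreducible), and that $R$ and $\overline R$ have the same residue field (residual rationality). Let $v$ be the normalized valuation of $\overline R$, write $\ell$ for the length of an $R$-module, $A:B=\{x\in K : xB\subseteq A\}$ and $A^*=R:A$ for $R$-submodules $A,B$ of $K$, and $v(A)=\{v(x): 0\ne x\in A\}$. Put $\gamma_R=R:\overline R$, $c=\ell(\overline R/\gamma_R)$, $\delta=\ell(\overline R/R)$, $n=c-\delta=\ell(R/\gamma_R)$. Let $s_0=0<s_1<s_2<\cdots$ be the elements of $v(R)$, let $R_i=\{x\in R: v(x)\ge s_i\}$, let $r_i=\ell\big((R:R_i)/(R:R_{i-1})\big)$ for $1\le i\le n$ (the type sequence of $R$), and let $r=r_1$ (the Cohen–Macaulay type of $R$). Let $I$ be an $\mathfrak m$-primary ideal of $R$ that is not principal, let $\Lambda=\bigcup_{m\ge 0}(I^m:I^m)$ be the blowing-up of $R$ along $I$, and put $$\Gamma=\{i\in\{1,\dots,n\} : s_{i-1}\in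 v(R:\Lambda)\},\qquad d(R:\Lambda)=\ell(\overline R/\Lambda^{**})-\sum_{i\in\Gamma}r_i .$$ The series $(1-z)\sum_{m\ge0}\ell(I^m/I^{m+1})z^m$ is a polynomial $h_I(z)\in\mathbb Z[z]$, and the genus $\rho=h_I'(1)$ of $I$ equals $\ell(\Lambda/R)$. Moreover: 1. $$\rho=\sum_{i\in\{1,\dots,n\}\setminus\Gamma}r_i-\ell(\Lambda^{**}/\Lambda)-d(R:\Lambda)\ \le\ r\cdot\ell\big(R/(R:\Lambda)\big).$$ If $\Lambda=\overline R$, then $\rho=\delta$ and $\ell(R/(R:\Lambda))=c-\delta$, so the inequality is Matlis' bound $\delta\le r(c-\delta)$. 2. There is an $i_0\in\mathbb N$ such that $s_{i_0}$ is the smallest element of $v(R:\Lambda)$, and for this $i_0$ $$\rho=\sum_{1\le i\le i_0}r_i-\ell(\Lambda^{**}/\Lambda)+\ell(\Lambda^{**}/R_{i_0}^*).$$ -/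

import Mathlib

open Polynomial

namespace Blowup

noncomputable section

/-- The length `ℓ_R(A / B)` as a natural number (used for `B ⊆ A` with quotient of finite length,
see `length_ne_top`). -/
def len {R : Type*} [CommRing R] {M : Type*} [AddCommGroup M] [Module R M]
    (A B : Submodule R M) : ℕ :=
  (Module.length R (A ⧸ B.submoduleOf A)).toNat

/-- Over a one-dimensional Noetherian domain, `A / B` has finite length as soon as `A` is finitely
generated and `a A ⊆ B` for some `a ≠ 0`; hence `len` is the honest length for all quotients of
nonzero ideals and fractional ideals below. -/
theorem length_ne_top {R M : Type*} [CommRing R] [IsDomain R] [IsNoetherianRing R]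
    [AddCommGroup M] [Module R M] (hdim : ringKrullDim R = 1)
    {A B : Submodule R M} (hA : A.FG) {a : R} (ha : a ≠ 0) (hB : ∀ x ∈ A, a • x ∈ B) :
    Module.length R (A ⧸ B.submoduleOf A) ≠ ⊤ := by
  have : Module.Finite R A := Module.Finite.iff_fg.mpr hA
  have htor : Module.IsTorsionBySet R (A ⧸ B.submoduleOf A) (Ideal.span {a} : Ideal R) := by
    rw [Module.isTorsionBySet_span_singleton_iff]
    intro x
    induction x using Submodule.Quotient.induction_on with
    | H x =>
      rw [← Submodule.Quotient.mk_smul, Submodule.Quotient.mk_eq_zero]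
      exact hB x x.2
  let _ : Module (R ⧸ (Ideal.span {a} : Ideal R)) (A ⧸ B.submoduleOf A) := htor.module
  have : IsScalarTower R (R ⧸ (Ideal.span {a} : Ideal R)) (A ⧸ B.submoduleOf A) :=
    htor.isScalarTower
  have hle : ringKrullDim (R ⧸ (Ideal.span {a} : Ideal R)) + 1 ≤ (1 : ℕ) := by
    have := hdim ▸
      ringKrullDim_quotient_succ_le_of_nonZeroDivisor (mem_nonZeroDivisors_of_ne_zero ha)
    simpa using this
  have : Ring.KrullDimLE 0 (R ⧸ (Ideal.span {a} : Ideal R)) := by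
    rw [Ring.krullDimLE_iff]
    refine ENat.WithBot.lt_add_one_iff.mp ?_
    simpa using ENat.WithBot.add_one_le_natCast_iff.mp hle
  have : IsArtinianRing (R ⧸ (Ideal.span {a} : Ideal R)) :=
    IsNoetherianRing.isArtinianRing_of_krullDimLE_zero
  have : Module.Finite (R ⧸ (Ideal.span {a} : Ideal R)) (A ⧸ B.submoduleOf A) :=
    Module.Finite.of_restrictScalars_finite R _ _
  have : IsArtinian R (A ⧸ B.submoduleOf A) :=
    isArtinian_of_surjective_algebraMap (R := R ⧸ (Ideal.span {a} : Ideal R))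
      Ideal.Quotient.mk_surjective
  exact Module.length_ne_top

/-- The Hilbert function `H_I(n) = ℓ_R(I^n / I^{n+1})`. -/
def hilbertFunction {R : Type*} [CommRing R] (I : Ideal R) (n : ℕ) : ℕ :=
  len (I ^ n) (I ^ (n + 1))

/-- The Hilbert-Poincaré series `P_I(z) = ∑ H_I(n) z^n`. -/
def hilbertSeries {R : Type*} [CommRing R] (I : Ideal R) : PowerSeries ℤ :=
  PowerSeries.mk fun n => (hilbertFunction I n : ℤ)

/-- `h` is the h-polynomial of `I`, i.e. `P_I(z) = h(z) / (1 - z)`. There is at most one such `h`.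
The genus of `I` is then `h'(1)`. -/
def IsHPolynomial {R : Type*} [CommRing R] (I : Ideal R) (h : ℤ[X]) : Prop :=
  (h : PowerSeries ℤ) = (1 - PowerSeries.X) * hilbertSeries I

section

variable {R : Type*} [CommRing R] (K : Type*) [Field K] [Algebra R K]

/-- The blowing-up `Λ(I) = ⋃_n (I^n : I^n)`, where `A : B = {x ∈ K | x B ⊆ A}` is the division of
submodules of `K`. The union is directed, see `mem_blowup`. -/
def blowup (I : Ideal R) : Submodule R K :=
  ⨆ n : ℕ, IsLocalization.coeSubmodule K (I ^ n) / IsLocalization.coeSubmodule K (I ^ n)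

theorem mem_blowup (I : Ideal R) (x : K) :
    x ∈ blowup K I ↔ ∃ n : ℕ,
      x ∈ IsLocalization.coeSubmodule K (I ^ n) / IsLocalization.coeSubmodule K (I ^ n) := by
  refine Submodule.mem_iSup_of_directed _ (Monotone.directed_le (monotone_nat_of_le_succ ?_))
  intro n y hy
  rw [Submodule.mem_div_iff_forall_mul_mem] at hy ⊢
  intro z hz
  rw [pow_succ, IsLocalization.coeSubmodule_mul] at hz ⊢
  induction hz using Submodule.mul_induction_on' with
  | mem_mul_mem a ha b hb => rw [← mul_assoc]; exact Submodule.mul_mem_mul (hy a ha) hb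
  | add a _ b _ h1 h2 => rw [mul_add]; exact add_mem h1 h2

/-- The dual `A^* = R : A` of a submodule `A` of the quotient field. -/
def dual (A : Submodule R K) : Submodule R K := 1 / A

variable (R)

/-- The integral closure `R̄` of `R` in `K`, as an `R`-submodule of `K`. -/
def Rbar : Submodule R K := Subalgebra.toSubmodule (integralClosure R K)

/-- The conductor ideal `γ_R = R : R̄`. -/
def conductor : Submodule R K := dual K (Rbar R K)

/-- `c = ℓ_R(R̄ / γ_R)`. -/
def c : ℕ := len (Rbar R K) (conductor R K)

/-- The singularity degree `δ = ℓ_R(R̄ / R)`. -/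
def delta : ℕ := len (Rbar R K) (1 : Submodule R K)

/-- `n = c - δ = ℓ_R(R / γ_R)`. -/
def n : ℕ := len (1 : Submodule R K) (conductor R K)

variable [IsDomain R] [IsDiscreteValuationRing (integralClosure R K)]

variable {R} in
/-- The normalized valuation of the discrete valuation ring `R̄`, restricted to `R`. -/
def val (x : R) : ℕ∞ :=
  IsDiscreteValuationRing.addVal (integralClosure R K) (algebraMap R (integralClosure R K) x)

variable {R} in
/-- The set of values `v(A)` of the nonzero elements of `A`, for `A` contained in `R`
(note that `val K 0 = ⊤`). -/
def values (A : Submodule R K) : Set ℕ :=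
  {s | ∃ x : R, algebraMap R K x ∈ A ∧ val K x = s}

/-- The increasing enumeration `s_0 = 0 < s_1 < ...` of the numerical semigroup `v(R)`. -/
def s (i : ℕ) : ℕ := Nat.nth (· ∈ values K (1 : Submodule R K)) i

/-- The ideal `R_i = {x ∈ R | v(x) ≥ s_i}`. -/
def Ri (i : ℕ) : Ideal R where
  carrier := {x | (s R K i : ℕ∞) ≤ val K x}
  zero_mem' := by simp [val]
  add_mem' {a b} ha hb := by
    simp only [Set.mem_ofPred_eq, val, map_add] at *
    exact (le_min ha hb).trans IsDiscreteValuationRing.addVal_add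
  smul_mem' a b hb := by
    simp only [Set.mem_ofPred_eq, val, smul_eq_mul, map_mul,
      IsDiscreteValuationRing.addVal_mul] at *
    exact hb.trans le_add_self

/-- The dual `R_i^* = R : R_i`. -/
def RiDual (i : ℕ) : Submodule R K := dual K (IsLocalization.coeSubmodule K (Ri R K i))

/-- The `i`-th entry `r_i = ℓ_R((R : R_i) / (R : R_{i-1}))` of the type sequence
(meaningful for `1 ≤ i ≤ n`); `r_1` is the Cohen-Macaulay type of `R`. -/
def r (i : ℕ) : ℕ := len (RiDual R K i) (RiDual R K (i - 1))

variable {R}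

open Classical in
/-- `Γ = {i ∈ {1, ..., n} | s_{i-1} ∈ v(R : Λ)}`. -/
def Gam (I : Ideal R) : Finset ℕ :=
  {i ∈ Finset.Icc 1 (n R K) | s R K (i - 1) ∈ values K (dual K (blowup K I))}

/-- `d(R : Λ) = ℓ_R(R̄ / Λ^{**}) - ∑_{i ∈ Γ} r_i`. -/
def d (I : Ideal R) : ℤ :=
  (len (Rbar R K) (dual K (dual K (blowup K I))) : ℤ) - ∑ i ∈ Gam K I, (r R K i : ℤ)

end

end

end Blowup

/-!
After scaling by an element of least value, `I` becomes an overmodule `J` of `R` inside `R̄`, and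
the ascending powers of `J` stabilise at `Λ`. Hence `I ^ m = x ^ m Λ` for large `m`, so the
Hilbert function is eventually `ℓ(Λ / xΛ)`, and comparing `ℓ(R / I ^ m)` with `ℓ(Λ / x ^ m Λ)` gives
`h_I'(1) = ℓ(Λ / R)`.

The formulas come from cutting chains of `R`-submodules of `K` containing `R`. By residual
rationality `R_i / R_{i+1}` has length one, so the conductor is `R_n`, and `∑ r_i` over `1 ≤ i ≤ k`
telescopes to `ℓ(R_k^* / R)`. For `k = n` this is `ℓ(R̄ / R)`, and one cuts `R ⊆ Λ ⊆ Λ^{**} ⊆ R̄`;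
for `k = i₀`, dualising `R : Λ ⊆ R_{i₀}` gives `R ⊆ R_{i₀}^* ⊆ Λ^{**}`. For the inequality,
dualising a simple step `B ⊆ A` costs at most `r`: multiplication by an element of `A` outside `B`
embeds `B^* / A^*` into `𝔪^* / R`.
-/

namespace Blowup

open IsLocalization IsLocalRing
open scoped Pointwise

section Length

variable {R M N : Type*} [CommRing R] [AddCommGroup M] [Module R M] [AddCommGroup N] [Module R N]
  {A B C : Submodule R M}

theorem length_quotient_eq_add (hCB : C ≤ B) (hBA : B ≤ A) :
    Module.length R (A ⧸ C.submoduleOf A) =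
      Module.length R (B ⧸ C.submoduleOf B) + Module.length R (A ⧸ B.submoduleOf A) := by
  have hker : C.submoduleOf B = (C.submoduleOf A).comap (Submodule.inclusion hBA) := rfl
  refine Module.length_eq_add_of_exact
    (Submodule.mapQ (C.submoduleOf B) (C.submoduleOf A) (Submodule.inclusion hBA) hker.le)
    (Submodule.factor (Submodule.comap_mono hCB))
    ?_ (Submodule.factor_surjective _) ?_
  · rw [← LinearMap.ker_eq_bot, Submodule.ker_mapQ, ← hker, Submodule.mkQ_map_self]
  · rw [LinearMap.exact_iff, Submodule.range_mapQ, Submodule.range_inclusion]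
    exact Submodule.ker_mapQ _ _ LinearMap.id _

theorem len_add_len (hCB : C ≤ B) (hBA : B ≤ A)
    (hfin : Module.length R (A ⧸ C.submoduleOf A) ≠ ⊤) : len A B + len B C = len A C := by
  have hlength := length_quotient_eq_add hCB hBA
  rw [hlength, ne_eq, ENat.add_eq_top, not_or] at hfin
  rw [len, len, len, hlength, ENat.toNat_add hfin.1 hfin.2, add_comm]

theorem len_map_map {f : M →ₗ[R] N} (hf : Function.Injective f) (A B : Submodule R M) :
    len (A.map f) (B.map f) = len A B := by
  let e := Submodule.equivMapOfInjective f hf A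
  have he : (B.submoduleOf A).map (e : A →ₗ[R] A.map f) = (B.map f).submoduleOf (A.map f) := by
    rw [Submodule.map_equiv_eq_comap_symm]
    ext y
    obtain ⟨x, rfl⟩ := e.surjective y
    simp [Submodule.submoduleOf, e, hf.eq_iff]
  exact congrArg ENat.toNat (Submodule.Quotient.equiv _ _ e he).length_eq.symm

theorem len_self (A : Submodule R M) : len A A = 0 := by
  simp [len, Submodule.submoduleOf_self]

theorem len_pos_of_lt (h : B < A) (hfin : Module.length R (A ⧸ B.submoduleOf A) ≠ ⊤) :
    0 < len A B := by
  refine Nat.pos_of_ne_zero fun h0 => h.not_ge ?_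
  rwa [len, ENat.toNat_eq_zero, or_iff_left hfin, Module.length_eq_zero_iff,
    Submodule.Quotient.subsingleton_iff, Submodule.submoduleOf_eq_top] at h0

theorem len_eq_one_of_covBy (h : B ⋖ A) : len A B = 1 := by
  have : IsSimpleModule R (A ⧸ B.submoduleOf A) := (covBy_iff_quot_is_simple h.le).mp h
  rw [len, Module.length_eq_one, ENat.toNat_one]

theorem len_inf_eq_len_sup (A B : Submodule R M) : len A (A ⊓ B) = len (A ⊔ B) B :=
  congrArg ENat.toNat (LinearMap.quotientInfEquivSupQuotient A B).length_eq

theorem smul_mem_of_covBy [IsLocalRing R] (h : B ⋖ A) {a : R} (ha : a ∈ maximalIdeal R) {x : M}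
    (hx : x ∈ A) : a • x ∈ B := by
  have : IsSimpleModule R (A ⧸ B.submoduleOf A) := (covBy_iff_quot_is_simple h.le).mp h
  rw [← eq_maximalIdeal (IsSimpleModule.annihilator_isMaximal (M := A ⧸ B.submoduleOf A)),
    Module.mem_annihilator] at ha
  exact (Submodule.Quotient.mk_eq_zero (B.submoduleOf A)).1 (ha (Submodule.Quotient.mk ⟨x, hx⟩))

end Length

section Dual

variable {R K : Type*} [CommRing R] [Field K] [Algebra R K] {A B : Submodule R K} {x : K}

theorem le_smul_iff (hx : x ≠ 0) : A ≤ x • B ↔ x⁻¹ • A ≤ B := by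
  refine ⟨fun h => ?_, fun h => ?_⟩
  · simpa only [inv_smul_smul₀ hx] using smul_le_smul_left x⁻¹ h
  · simpa only [smul_inv_smul₀ hx] using smul_le_smul_left x h

theorem smul_div_smul (hx : x ≠ 0) : (x • A) / (x • B) = A / B := by
  refine eq_of_forall_le_iff fun C => ?_
  rw [Submodule.le_div_iff_mul_le, Submodule.le_div_iff_mul_le, le_smul_iff hx, mul_smul_comm,
    inv_smul_smul₀ hx]

theorem smul_ne_bot (hx : x ≠ 0) (hA : A ≠ ⊥) : x • A ≠ ⊥ := fun h =>
  hA (by rw [← inv_smul_smul₀ hx A, h, Submodule.smul_bot'])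

theorem pow_smul_le (h : x • A ≤ A) : ∀ m : ℕ, x ^ m • A ≤ A
  | 0 => by rw [pow_zero, one_smul]
  | m + 1 => by
    rw [pow_succ, mul_smul]
    exact (smul_le_smul_left _ h).trans (pow_smul_le h m)

theorem len_smul_smul (hx : x ≠ 0) (A B : Submodule R K) : len (x • A) (x • B) = len A B :=
  len_map_map (f := DistribSMul.toLinearMap R K x) (smul_right_injective K hx) A B

theorem mem_dual : x ∈ dual K A ↔ ∀ y ∈ A, x * y ∈ (1 : Submodule R K) :=
  Submodule.mem_div_iff_forall_mul_mem

theorem le_dual_iff : A ≤ dual K B ↔ A * B ≤ 1 := Submodule.le_div_iff_mul_le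

theorem dual_antitone : Antitone (dual K : Submodule R K → Submodule R K) := fun _ _ h =>
  le_dual_iff.2 ((mul_le_mul_right h _).trans (le_dual_iff.1 le_rfl))

theorem le_dual_dual (A : Submodule R K) : A ≤ dual K (dual K A) :=
  le_dual_iff.2 Submodule.mul_one_div_le_one

theorem dual_one : dual K (1 : Submodule R K) = 1 :=
  eq_of_forall_le_iff fun A => by rw [le_dual_iff, mul_one]

theorem dual_sup (A B : Submodule R K) : dual K (A ⊔ B) = dual K A ⊓ dual K B :=
  eq_of_forall_le_iff fun C => by
    rw [le_inf_iff, le_dual_iff, le_dual_iff, le_dual_iff, Submodule.mul_sup, sup_le_iff]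

theorem smul_dual_smul (hx : x ≠ 0) (A : Submodule R K) : x • dual K (x • A) = dual K A := by
  refine eq_of_forall_le_iff fun C => ?_
  rw [le_smul_iff hx, le_dual_iff, le_dual_iff, smul_mul_smul, inv_mul_cancel₀ hx, one_smul]

theorem dual_le_one (hA : 1 ≤ A) : dual K A ≤ 1 := (dual_antitone hA).trans dual_one.le

theorem smul_dual_sup_span (hx : x ≠ 0) (A : Submodule R K) :
    x • dual K (A ⊔ R ∙ x) = x • dual K A ⊓ 1 := by
  refine eq_of_forall_le_iff fun C => ?_
  rw [le_inf_iff, le_smul_iff hx, le_smul_iff hx, dual_sup, le_inf_iff, le_dual_iff (B := R ∙ x),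
    ← Submodule.smul_one_eq_span, smul_mul_smul, inv_mul_cancel₀ hx, one_smul, mul_one]

theorem coeSubmodule_le_one (I : Ideal R) : coeSubmodule K I ≤ 1 :=
  (coeSubmodule_mono K le_top).trans (coeSubmodule_top K).le

theorem one_le_dual_coeSubmodule (I : Ideal R) : 1 ≤ dual K (coeSubmodule K I) :=
  le_dual_iff.2 (by simpa only [one_mul] using coeSubmodule_le_one I)

theorem smul_dual_le_dual_maximalIdeal [IsLocalRing R] (h : B ⋖ A) (hx : x ∈ A) :
    x • dual K B ≤ dual K (coeSubmodule K (maximalIdeal R)) := by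
  have hxB : x • coeSubmodule K (maximalIdeal R) ≤ B := by
    rintro _ ⟨_, ⟨a, ha, rfl⟩, rfl⟩
    simpa [Algebra.smul_def, mul_comm] using smul_mem_of_covBy h ha hx
  rw [le_dual_iff, smul_mul_assoc, ← mul_smul_comm]
  exact le_dual_iff.1 (dual_antitone hxB)

theorem fg_dual [IsNoetherianRing R] (hA : A ≠ ⊥) : (dual K A).FG := by
  obtain ⟨x, hxA, hx⟩ := A.ne_bot_iff.1 hA
  have hle : dual K A ≤ R ∙ x⁻¹ := by
    rw [← Submodule.smul_one_eq_span, le_smul_iff (inv_ne_zero hx), inv_inv]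
    rintro _ ⟨y, hy, rfl⟩
    simpa [mul_comm] using mem_dual.1 hy x hxA
  exact (Submodule.fg_span_singleton _).of_le hle

end Dual

theorem maximalIdeal_ne_bot {R : Type*} [CommRing R] [IsLocalRing R]
    (hdim : ringKrullDim R = 1) : maximalIdeal R ≠ ⊥ := by
  intro h
  rw [ringKrullDim_eq_zero_of_isField (isField_iff_maximalIdeal_eq.2 h)] at hdim
  exact zero_ne_one hdim

section FractionalIdeal

variable {R K : Type*} [CommRing R] [Field K] [Algebra R K] [IsFractionRing R K]
  {A B C : Submodule R K}

theorem coeSubmodule_ne_bot {I : Ideal R} (hI : I ≠ ⊥) : coeSubmodule K I ≠ ⊥ :=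
  coeSubmodule_bot K (R := R) ▸ (IsFractionRing.coeSubmodule_injective R K).ne hI

theorem fg_coeSubmodule [IsNoetherianRing R] (I : Ideal R) : (coeSubmodule K I).FG :=
  (coeSubmodule_fg K (IsFractionRing.injective R K) I).2 (IsNoetherian.noetherian I)

theorem fg_one [IsNoetherianRing R] : (1 : Submodule R K).FG :=
  coeSubmodule_top K (R := R) ▸ fg_coeSubmodule ⊤

variable [IsDomain R]

theorem exists_ne_zero_algebraMap_mem (hA : A ≠ ⊥) : ∃ a : R, a ≠ 0 ∧ algebraMap R K a ∈ A := by
  obtain ⟨x, hxA, hx⟩ := A.ne_bot_iff.1 hA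
  obtain ⟨⟨a, b⟩, hab⟩ := IsLocalization.surj (nonZeroDivisors R) x
  refine ⟨a, ?_, ?_⟩
  · rintro rfl
    simp [hx, nonZeroDivisors.ne_zero b.2] at hab
  · rw [← hab, mul_comm, ← Algebra.smul_def]
    exact A.smul_mem _ hxA

theorem dual_ne_bot (hA : A.FG) : dual K A ≠ ⊥ := by
  obtain ⟨a, ha, haA⟩ := FractionalIdeal.isFractional_of_fg (S := nonZeroDivisors R) hA
  refine (Submodule.ne_bot_iff _).2 ⟨algebraMap R K a, mem_dual.2 fun y hy => ?_,
    IsFractionRing.to_map_ne_zero_of_mem_nonZeroDivisors ha⟩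
  rw [← Algebra.smul_def]
  exact Submodule.mem_one.2 (haA y hy)

variable [IsNoetherianRing R]

theorem length_ne_top_of_fg (hdim : ringKrullDim R = 1) (hA : A.FG) (hB : B ≠ ⊥) :
    Module.length R (A ⧸ B.submoduleOf A) ≠ ⊤ := by
  obtain ⟨b, hb, hbB⟩ := exists_ne_zero_algebraMap_mem hB
  obtain ⟨a, ha, haA⟩ := exists_ne_zero_algebraMap_mem (dual_ne_bot hA)
  refine length_ne_top hdim hA (mul_ne_zero hb ha) fun x hx => ?_
  obtain ⟨e, he⟩ := Submodule.mem_one.1 (mem_dual.1 haA x hx)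
  have hab : (b * a) • x = e • algebraMap R K b := by
    rw [mul_smul, Algebra.smul_def a, ← he, Algebra.smul_def, Algebra.smul_def, mul_comm]
  rw [hab]
  exact B.smul_mem e hbB

theorem len_add_len_of_fg (hdim : ringKrullDim R = 1) (hA : A.FG) (hC : C ≠ ⊥) (hCB : C ≤ B)
    (hBA : B ≤ A) : len A B + len B C = len A C :=
  len_add_len hCB hBA (length_ne_top_of_fg hdim hA hC)

theorem len_dual_le_of_covBy [IsLocalRing R] (hdim : ringKrullDim R = 1) (h : B ⋖ A) :
    len (dual K B) (dual K A) ≤ len (dual K (coeSubmodule K (maximalIdeal R))) 1 := by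
  obtain ⟨x, hxA, hxB⟩ := Set.exists_of_ssubset h.lt
  have hx : x ≠ 0 := ne_of_mem_of_not_mem B.zero_mem hxB |>.symm
  have hA : B ⊔ R ∙ x = A :=
    (h.eq_or_eq le_sup_left (sup_le h.le (by simpa using hxA))).resolve_left fun hB =>
      hxB (hB ▸ Submodule.mem_sup_right (Submodule.mem_span_singleton_self x))
  set D := dual K (coeSubmodule K (maximalIdeal R))
  have hD : x • dual K B ⊔ 1 ≤ D :=
    sup_le (smul_dual_le_dual_maximalIdeal h hxA) (one_le_dual_coeSubmodule _)
  have hDfg : D.FG := fg_dual (coeSubmodule_ne_bot (maximalIdeal_ne_bot hdim))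
  calc len (dual K B) (dual K A)
    _ = len (x • dual K B) (x • dual K B ⊓ 1) := by
      rw [← len_smul_smul hx, ← hA, smul_dual_sup_span hx]
    _ = len (x • dual K B ⊔ 1) 1 := len_inf_eq_len_sup _ _
    _ ≤ len D 1 := by
      rw [← len_add_len_of_fg hdim hDfg one_ne_zero le_sup_right hD]
      exact Nat.le_add_left _ _

theorem len_dual_le [IsLocalRing R] (hdim : ringKrullDim R = 1) (hA : A.FG) (hB : B ≠ ⊥)
    (h : B ≤ A) :
    len (dual K B) (dual K A) ≤
      len (dual K (coeSubmodule K (maximalIdeal R))) 1 * len A B := by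
  induction hk : len A B using Nat.strong_induction_on generalizing A B with
  | _ k ih =>
    rcases h.eq_or_lt with rfl | hlt
    · simp [len_self]
    by_cases hcov : B ⋖ A
    · rw [← hk, len_eq_one_of_covBy hcov, mul_one]
      exact len_dual_le_of_covBy hdim hcov
    obtain ⟨C, hBC, hCA⟩ := exists_lt_lt_of_not_covBy hlt hcov
    have hC : C ≠ ⊥ := ne_bot_of_le_ne_bot hB hBC.le
    have hCfg : C.FG := hA.of_le hCA.le
    have hAC : 0 < len A C := len_pos_of_lt hCA (length_ne_top_of_fg hdim hA hC)
    have hCB : 0 < len C B := len_pos_of_lt hBC (length_ne_top_of_fg hdim hCfg hB)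
    have hadd : len A C + len C B = len A B := len_add_len_of_fg hdim hA hB hBC.le hCA.le
    rw [← len_add_len_of_fg hdim (fg_dual hB) (dual_ne_bot hA) (dual_antitone hCA.le)
      (dual_antitone hBC.le), ← hk, ← hadd, mul_add, add_comm]
    exact add_le_add (ih _ (by lia) hA hC hCA.le rfl) (ih _ (by lia) hCfg hB hBC.le rfl)

end FractionalIdeal

section HilbertSeries

variable {R : Type*} [CommRing R]

theorem exists_isHPolynomial (I : Ideal R) {N e : ℕ} (hN : ∀ m, N ≤ m → hilbertFunction I m = e) :
    ∃ h : ℤ[X], IsHPolynomial I h ∧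
      (derivative h).eval 1 = N * e - ∑ m ∈ Finset.range N, (hilbertFunction I m : ℤ) := by
  set p : ℤ[X] := ∑ m ∈ Finset.range N, C (hilbertFunction I m : ℤ) * X ^ m with hp
  refine ⟨C (e : ℤ) * X ^ N + (1 - X) * p, ?_, ?_⟩
  · have hseries : hilbertSeries I =
        (p : PowerSeries ℤ) + PowerSeries.C (e : ℤ) * PowerSeries.X ^ N * PowerSeries.mk 1 := by
      ext m
      rw [hilbertSeries, PowerSeries.coeff_mk, map_add, coeff_coe, hp, finsetSum_coeff, mul_assoc,
        PowerSeries.coeff_C_mul, PowerSeries.coeff_X_pow_mul']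
      simp only [coeff_C_mul_X_pow, Finset.sum_ite_eq, Finset.mem_range]
      rcases lt_or_ge m N with h | h
      · simp [h, h.not_ge]
      · simp [h, h.not_gt, hN m h]
    rw [IsHPolynomial, hseries]
    push_cast
    linear_combination (-PowerSeries.C (e : ℤ) * PowerSeries.X ^ N) *
      PowerSeries.mk_one_mul_one_sub_eq_one ℤ
  · have hp1 : p.eval 1 = ∑ m ∈ Finset.range N, (hilbertFunction I m : ℤ) := by
      simp [hp, eval_finsetSum]
    simp [hp1, derivative_X_pow]
    ring

variable {K : Type*} [Field K] [Algebra R K] [IsFractionRing R K]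

theorem hilbertFunction_eq_len (I : Ideal R) (m : ℕ) :
    hilbertFunction I m = len (coeSubmodule K (I ^ m)) (coeSubmodule K (I ^ (m + 1))) :=
  (len_map_map (IsFractionRing.injective R K) _ _).symm

theorem sum_hilbertFunction [IsDomain R] [IsNoetherianRing R] (hdim : ringKrullDim R = 1)
    {I : Ideal R} (hI : I ≠ ⊥) (N : ℕ) :
    ∑ m ∈ Finset.range N, hilbertFunction I m = len 1 (coeSubmodule K (I ^ N)) := by
  induction N with
  | zero => simp [Ideal.one_eq_top, len_self]
  | succ N ih =>
    rw [Finset.sum_range_succ, ih, hilbertFunction_eq_len (K := K)]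
    exact len_add_len_of_fg hdim fg_one (coeSubmodule_ne_bot (pow_ne_zero _ hI))
      (coeSubmodule_mono K (Ideal.pow_le_pow_right N.le_succ)) (coeSubmodule_le_one _)

end HilbertSeries

section IntegralClosure

variable {R K : Type*} [CommRing R] [Field K] [Algebra R K]

theorem one_le_Rbar : 1 ≤ Rbar R K :=
  Submodule.one_le.2 (one_mem (integralClosure R K))

theorem Rbar_mul_Rbar : Rbar R K * Rbar R K = Rbar R K :=
  (integralClosure R K).isIdempotentElem_toSubmodule

theorem pow_le_Rbar {J : Submodule R K} (hJ : J ≤ Rbar R K) : ∀ m : ℕ, J ^ m ≤ Rbar R K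
  | 0 => one_le_Rbar
  | m + 1 => by
    rw [pow_succ]
    exact (mul_le_mul' (pow_le_Rbar hJ m) hJ).trans Rbar_mul_Rbar.le

theorem fg_Rbar [Module.Finite R (integralClosure R K)] : (Rbar R K).FG :=
  Module.Finite.iff_fg.1 ‹Module.Finite R (integralClosure R K)›

theorem exists_pow_stable [IsNoetherianRing R] [Module.Finite R (integralClosure R K)]
    {J : Submodule R K} (h1 : 1 ≤ J) (hJ : J ≤ Rbar R K) : ∃ N, ∀ m, N ≤ m → J ^ m = J ^ N := by
  have : IsNoetherian R (Rbar R K) := isNoetherian_of_fg_of_noetherian _ fg_Rbar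
  obtain ⟨N, hN⟩ := monotone_stabilizes_iff_noetherian.2 this
    ⟨fun m => (J ^ m).submoduleOf (Rbar R K),
      fun _ _ hab => Submodule.comap_mono (pow_le_pow_right₀ h1 hab)⟩
  refine ⟨N, fun m hm => ?_⟩
  have hmap := congrArg (Submodule.map (Rbar R K).subtype) (hN m hm).symm
  simpa only [OrderHom.coe_mk, Submodule.submoduleOf, Submodule.map_comap_subtype,
    inf_eq_right.2 (pow_le_Rbar hJ _)] using hmap

theorem iSup_pow_div_pow {J : Submodule R K} (h1 : 1 ≤ J) {N : ℕ}
    (hN : ∀ m, N ≤ m → J ^ m = J ^ N) : ⨆ m : ℕ, J ^ m / J ^ m = J ^ N := by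
  refine le_antisymm (iSup_le fun m => ?_) (le_trans ?_ (le_iSup _ N))
  · calc J ^ m / J ^ m
      _ ≤ J ^ m := by
        simpa only [mul_one] using (mul_le_mul_right (one_le_pow₀ h1) _).trans
          (Submodule.le_div_iff_mul_le.1 (le_refl (J ^ m / J ^ m)))
      _ ≤ J ^ (m + N) := pow_le_pow_right₀ h1 (Nat.le_add_right m N)
      _ = J ^ N := hN _ (Nat.le_add_left N m)
  · rw [Submodule.le_div_iff_mul_le, ← pow_add, hN _ (Nat.le_add_left N N)]

variable [IsDiscreteValuationRing (integralClosure R K)]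

theorem val_le_val_iff {x y : R} :
    val K x ≤ val K y ↔ algebraMap R K y ∈ algebraMap R K x • Rbar R K := by
  rw [val, val, IsDiscreteValuationRing.addVal_le_iff_dvd]
  constructor
  · rintro ⟨z, hz⟩
    exact ⟨z, z.2, (congrArg Subtype.val hz).symm⟩
  · rintro ⟨z, hz, hzy⟩
    exact ⟨⟨z, hz⟩, Subtype.ext hzy.symm⟩

theorem exists_coeSubmodule_le_smul_Rbar {I : Ideal R} (hI : I ≠ ⊥) :
    ∃ x ∈ I, x ≠ 0 ∧ coeSubmodule K I ≤ algebraMap R K x • Rbar R K := by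
  obtain ⟨x, ⟨hxI, hx⟩, hmin⟩ :=
    exists_minimalFor_of_wellFoundedLT (fun y => y ∈ I ∧ y ≠ 0) (val K) (I.ne_bot_iff.1 hI)
  refine ⟨x, hxI, hx, ?_⟩
  rintro _ ⟨y, hy, rfl⟩
  rcases eq_or_ne y 0 with rfl | hy0
  · simp
  · exact val_le_val_iff.1 ((le_total _ _).elim id (hmin ⟨hy, hy0⟩))

end IntegralClosure

section BlowingUp

variable {R K : Type*} [CommRing R] [Field K] [Algebra R K]

theorem coeSubmodule_pow (I : Ideal R) (m : ℕ) : coeSubmodule K (I ^ m) = coeSubmodule K I ^ m := by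
  induction m with
  | zero => rw [pow_zero, pow_zero, Ideal.one_eq_top, coeSubmodule_top]
  | succ m ih => rw [pow_succ, pow_succ, coeSubmodule_mul, ih]

theorem one_le_blowup (I : Ideal R) : 1 ≤ blowup K I :=
  Submodule.one_le.2 ((mem_blowup K I 1).2 ⟨0, Submodule.one_mem_div.2 le_rfl⟩)

theorem blowup_eq_pow {I : Ideal R} {x : K} (hx : x ≠ 0) {J : Submodule R K} (h1 : 1 ≤ J)
    (hJ : coeSubmodule K I = x • J) {N : ℕ} (hN : ∀ m, N ≤ m → J ^ m = J ^ N) :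
    blowup K I = J ^ N := by
  rw [← iSup_pow_div_pow h1 hN]
  simp only [blowup, coeSubmodule_pow, hJ, _root_.smul_pow, smul_div_smul (pow_ne_zero _ hx)]

variable [IsNoetherianRing R] [IsFractionRing R K]

theorem exists_coeSubmodule_pow_eq_smul_blowup [Module.Finite R (integralClosure R K)]
    [IsDiscreteValuationRing (integralClosure R K)] {I : Ideal R} (hI : I ≠ ⊥) :
    ∃ x : R, x ≠ 0 ∧
      ∃ N, ∀ m, N ≤ m → coeSubmodule K (I ^ m) = algebraMap R K x ^ m • blowup K I := by
  obtain ⟨x, hxI, hx, hle⟩ := exists_coeSubmodule_le_smul_Rbar (K := K) hI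
  have hxK : algebraMap R K x ≠ 0 := by simpa using hx
  set J := (algebraMap R K x)⁻¹ • coeSubmodule K I
  have hIJ : coeSubmodule K I = algebraMap R K x • J := (smul_inv_smul₀ hxK _).symm
  have h1 : 1 ≤ J := Submodule.one_le.2 ⟨algebraMap R K x, ⟨x, hxI, rfl⟩, inv_mul_cancel₀ hxK⟩
  obtain ⟨N, hN⟩ := exists_pow_stable h1 ((le_smul_iff hxK).1 hle)
  refine ⟨x, hx, N, fun m hm => ?_⟩
  rw [coeSubmodule_pow, blowup_eq_pow hxK h1 hIJ hN, hIJ, _root_.smul_pow, hN m hm]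

variable [IsDomain R]

theorem blowup_le_Rbar {I : Ideal R} (hI : I ≠ ⊥) : blowup K I ≤ Rbar R K := fun z hz => by
  obtain ⟨m, hm⟩ := (mem_blowup K I z).1 hz
  exact isIntegral_of_smul_mem_submodule _ (coeSubmodule_ne_bot (pow_ne_zero m hI))
    (fg_coeSubmodule _) z (Submodule.mem_div_iff_forall_mul_mem.1 hm)

theorem len_pow_smul (hdim : ringKrullDim R = 1) {A : Submodule R K} (hA : A.FG) (hA0 : A ≠ ⊥)
    {x : K} (hx : x ≠ 0) (hxA : x • A ≤ A) (N : ℕ) : len A (x ^ N • A) = N * len A (x • A) := by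
  induction N with
  | zero => simp [len_self]
  | succ N ih =>
    have hsmul : x ^ (N + 1) • A = x • x ^ N • A := by rw [pow_succ', mul_smul]
    have hle : x • x ^ N • A ≤ x • A := smul_le_smul_left x (pow_smul_le hxA N)
    rw [hsmul, ← len_add_len_of_fg hdim hA (smul_ne_bot hx (smul_ne_bot (pow_ne_zero N hx) hA0))
      hle hxA, len_smul_smul hx, ih]
    ring

theorem exists_isHPolynomial_derivative_eq_len_blowup
    [Module.Finite R (integralClosure R K)] [IsDiscreteValuationRing (integralClosure R K)]
    (hdim : ringKrullDim R = 1) {I : Ideal R} (hI : I ≠ ⊥) :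
    ∃ h : ℤ[X], IsHPolynomial I h ∧ (derivative h).eval 1 = (len (blowup K I) 1 : ℤ) := by
  obtain ⟨x, hx, N, hN⟩ := exists_coeSubmodule_pow_eq_smul_blowup (K := K) hI
  have hxK : algebraMap R K x ≠ 0 := by simpa using hx
  set Λ := blowup K I
  have hfg : Λ.FG := fg_Rbar.of_le (blowup_le_Rbar hI)
  have hne : Λ ≠ ⊥ := ne_bot_of_le_ne_bot one_ne_zero (one_le_blowup I)
  have hxΛ : algebraMap R K x • Λ ≤ Λ := by
    rintro _ ⟨y, hy, rfl⟩
    simpa [Algebra.smul_def] using Λ.smul_mem x hy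
  obtain ⟨h, hh, hder⟩ := exists_isHPolynomial I (N := N) (e := len Λ (algebraMap R K x • Λ))
    fun m hm => by
      rw [hilbertFunction_eq_len (K := K), hN m hm, hN (m + 1) (by lia), pow_succ, mul_smul,
        len_smul_smul (pow_ne_zero m hxK)]
  have hadd : len Λ 1 + len 1 (algebraMap R K x ^ N • Λ) = len Λ (algebraMap R K x ^ N • Λ) :=
    len_add_len_of_fg hdim hfg (smul_ne_bot (pow_ne_zero N hxK) hne)
      (hN N le_rfl ▸ coeSubmodule_le_one _) (one_le_blowup I)
  rw [len_pow_smul hdim hfg hne hxK hxΛ, ← hN N le_rfl, ← sum_hilbertFunction hdim hI] at hadd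
  refine ⟨h, hh, ?_⟩
  rw [hder, sub_eq_iff_eq_add]
  exact_mod_cast hadd.symm

end BlowingUp

section Valuation

variable {R K : Type*} [CommRing R] [Field K] [Algebra R K]

variable (R K) in
/-- Residual rationality: the residue field of the integral closure of `R` in `K` is a quotient of
`R`, that is, it coincides with the residue field of `R` when `R` is local. -/
def IsResiduallyRational [IsLocalRing (integralClosure R K)] : Prop :=
  Function.Surjective
    ((residue (integralClosure R K)).comp (algebraMap R (integralClosure R K)))

variable [IsDiscreteValuationRing (integralClosure R K)]

theorem val_pow (x : R) (k : ℕ) : val K (x ^ k) = k • val K x := by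
  rw [val, map_pow, IsDiscreteValuationRing.addVal_pow, val]

theorem exists_lt_val_sub (hres : IsResiduallyRational R K) {y z : R} (hy : val K y ≠ ⊤)
    (hyz : val K y = val K z) : ∃ a : R, val K y < val K (z - a * y) := by
  obtain ⟨u, hu⟩ := IsDiscreteValuationRing.addVal_le_iff_dvd.1 hyz.le
  obtain ⟨a, ha⟩ := hres (residue _ u)
  refine ⟨a, ?_⟩
  have hfactor : algebraMap R (integralClosure R K) (z - a * y) =
      algebraMap R _ y * (u - algebraMap R _ a) := by
    rw [map_sub, map_mul, hu]
    ring
  have hpos : IsDiscreteValuationRing.addVal (integralClosure R K) (u - algebraMap R _ a) ≠ 0 := by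
    rw [ne_eq, IsDiscreteValuationRing.addVal_eq_zero_iff, ← mem_nonunits_iff, ← mem_maximalIdeal,
      ← residue_eq_zero_iff, map_sub, sub_eq_zero]
    exact ha.symm
  calc val K y
    _ < val K y + 1 := (ENat.add_one_le_iff hy).1 le_rfl
    _ ≤ val K y + IsDiscreteValuationRing.addVal _ (u - algebraMap R _ a) := by
      gcongr
      exact Order.one_le_iff_pos.2 (pos_iff_ne_zero.2 hpos)
    _ = val K (z - a * y) := by rw [val, val, hfactor, IsDiscreteValuationRing.addVal_mul]

variable [FaithfulSMul R K]

instance faithfulSMul_integralClosure : FaithfulSMul R (integralClosure R K) :=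
  FaithfulSMul.tower_bot R (integralClosure R K) K

theorem val_eq_zero_iff {x : R} : val K x = 0 ↔ IsUnit x := by
  rw [val, IsDiscreteValuationRing.addVal_eq_zero_iff, isUnit_map_iff]

theorem val_eq_top_iff {x : R} : val K x = ⊤ ↔ x = 0 := by
  rw [val, IsDiscreteValuationRing.addVal_eq_top_iff, FaithfulSMul.algebraMap_eq_zero_iff]

theorem infinite_values_one : (Set.ofPred (· ∈ values K (1 : Submodule R K))).Infinite := by
  have : IsDomain R := (FaithfulSMul.algebraMap_injective R K).isDomain (algebraMap R K)
  have hR : ¬ IsField R := fun h => IsDiscreteValuationRing.not_isField (integralClosure R K)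
    ((Algebra.IsIntegral.isField_iff_isField (FaithfulSMul.algebraMap_injective R _)).1 h)
  obtain ⟨x, hx0, hx⟩ := Ring.exists_not_isUnit_of_not_isField hR
  obtain ⟨e, he⟩ := ENat.ne_top_iff_exists.1 (mt (val_eq_top_iff (K := K)).1 hx0)
  have hepos : 0 < e := Nat.pos_of_ne_zero (by
    rintro rfl
    exact hx (val_eq_zero_iff.1 he.symm))
  refine Set.infinite_of_forall_exists_gt fun k =>
    ⟨(k + 1) * e, ⟨x ^ (k + 1), Submodule.algebraMap_mem _, ?_⟩, by nlinarith⟩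
  rw [val_pow, ← he, nsmul_eq_mul]
  push_cast
  rfl

end Valuation

section TypeSequence

variable {R K : Type*} [CommRing R] [Field K] [Algebra R K]
  [IsDiscreteValuationRing (integralClosure R K)]

theorem mem_values_one {k : ℕ} : k ∈ values K (1 : Submodule R K) ↔ ∃ x : R, val K x = k := by
  simp [values, Submodule.mem_one]

theorem mem_Ri {i : ℕ} {x : R} : x ∈ Ri R K i ↔ s R K i ≤ val K x := Iff.rfl

theorem one_le_RiDual (i : ℕ) : 1 ≤ RiDual R K i := one_le_dual_coeSubmodule _

theorem RiDual_le_dual {A : Submodule R K} (hA : A ≤ 1) {i : ℕ}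
    (hi : s R K i ∈ lowerBounds (values K A)) : RiDual R K i ≤ dual K A := by
  refine dual_antitone fun x hx => ?_
  obtain ⟨b, rfl⟩ := Submodule.mem_one.1 (hA hx)
  refine (mem_coeSubmodule K _).2 ⟨b, mem_Ri.2 ?_, rfl⟩
  rcases eq_or_ne (val K b) ⊤ with hb | hb
  · exact hb ▸ le_top
  · obtain ⟨k, hk⟩ := ENat.ne_top_iff_exists.1 hb
    exact hk ▸ Nat.cast_le.2 (hi ⟨b, hx, hk.symm⟩)

variable [FaithfulSMul R K]

theorem s_zero : s R K 0 = 0 :=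
  Nat.nth_zero_of_zero (mem_values_one.2 ⟨1, val_eq_zero_iff.2 isUnit_one⟩)

theorem s_strictMono : StrictMono (s R K) := Nat.nth_strictMono infinite_values_one

theorem range_s : Set.range (s R K) = values K (1 : Submodule R K) :=
  Nat.range_nth_of_infinite infinite_values_one

theorem exists_val_eq_s (i : ℕ) : ∃ x : R, val K x = s R K i :=
  mem_values_one.1 (range_s.le ⟨i, rfl⟩)

theorem exists_s_eq_val {x : R} (hx : x ≠ 0) : ∃ i, (s R K i : ℕ∞) = val K x := by
  obtain ⟨k, hk⟩ := ENat.ne_top_iff_exists.1 (mt (val_eq_top_iff (K := K)).1 hx)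
  obtain ⟨i, hi⟩ := range_s.ge (mem_values_one.2 ⟨x, hk.symm⟩)
  exact ⟨i, by rw [hi, hk]⟩

theorem s_succ_le_val {i : ℕ} {x : R} (h : s R K i < val K x) : s R K (i + 1) ≤ val K x := by
  rcases eq_or_ne x 0 with rfl | hx
  · exact le_top.trans_eq (val_eq_top_iff.2 rfl).symm
  · obtain ⟨j, hj⟩ := exists_s_eq_val (K := K) hx
    rw [← hj, Nat.cast_lt, s_strictMono.lt_iff_lt] at h
    rw [← hj, Nat.cast_le, s_strictMono.le_iff_le]
    exact h

theorem Ri_antitone : Antitone (Ri R K) := fun _ _ hij _ hx =>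
  (Nat.cast_le.2 (s_strictMono.monotone hij)).trans (mem_Ri.1 hx)

theorem Ri_ne_bot (i : ℕ) : Ri R K i ≠ ⊥ := by
  obtain ⟨x, hx⟩ := exists_val_eq_s (R := R) (K := K) i
  refine (Submodule.ne_bot_iff _).2 ⟨x, mem_Ri.2 hx.ge, fun hx0 => ?_⟩
  exact ENat.top_ne_natCast _ ((val_eq_top_iff.2 hx0).symm.trans hx)

theorem Ri_zero : Ri R K 0 = ⊤ := by
  ext x
  simp [mem_Ri, s_zero]

theorem Ri_one [IsLocalRing R] : Ri R K 1 = maximalIdeal R := by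
  ext x
  have hs : (0 : ℕ∞) < s R K 1 := by
    exact_mod_cast (s_zero (R := R) (K := K)).ge.trans_lt (s_strictMono zero_lt_one)
  rw [mem_Ri, mem_maximalIdeal, mem_nonunits_iff, ← val_eq_zero_iff (K := K), ← ne_eq,
    ← pos_iff_ne_zero]
  exact ⟨hs.trans_le, fun h => s_succ_le_val (by rwa [s_zero, Nat.cast_zero])⟩

theorem Ri_succ_covBy (hres : IsResiduallyRational R K) (i : ℕ) : Ri R K (i + 1) ⋖ Ri R K i := by
  refine ⟨lt_of_le_not_ge (Ri_antitone i.le_succ) fun h => ?_, fun C h1 h2 => h2.not_ge ?_⟩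
  · obtain ⟨x, hx⟩ := exists_val_eq_s (R := R) (K := K) i
    have hle := mem_Ri.1 (h (mem_Ri.2 hx.ge))
    rw [hx, Nat.cast_le] at hle
    exact hle.not_gt (s_strictMono i.lt_succ_self)
  · have hval : ∀ {w : R}, w ∈ Ri R K i → w ∉ Ri R K (i + 1) → val K w = s R K i :=
      fun hw hw' => ((mem_Ri.1 hw).eq_or_lt.resolve_right fun h => hw' (s_succ_le_val h)).symm
    obtain ⟨y, hyC, hy⟩ := Set.exists_of_ssubset h1
    have hvy := hval (h2.le hyC) hy
    intro z hz
    by_cases hz' : z ∈ Ri R K (i + 1)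
    · exact h1.le hz'
    · obtain ⟨a, ha⟩ := exists_lt_val_sub hres (hvy ▸ ENat.natCast_ne_top _)
        (hvy.trans (hval hz hz').symm)
      have hzy : z - a * y ∈ C := h1.le (mem_Ri.2 (s_succ_le_val (hvy ▸ ha)))
      simpa only [sub_add_cancel] using C.add_mem hzy (C.mul_mem_left a hyC)

theorem RiDual_zero : RiDual R K 0 = 1 := by
  rw [RiDual, Ri_zero, coeSubmodule_top, dual_one]

theorem RiDual_mono : Monotone (RiDual R K) := fun _ _ hij =>
  dual_antitone (coeSubmodule_mono K (Ri_antitone hij))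

theorem r_one [IsLocalRing R] : r R K 1 = len (dual K (coeSubmodule K (maximalIdeal R))) 1 := by
  rw [r, Nat.sub_self, RiDual_zero, RiDual, Ri_one]

end TypeSequence

section FractionField

variable {R K : Type*} [CommRing R] [Field K] [Algebra R K] [IsFractionRing R K]
  [IsDiscreteValuationRing (integralClosure R K)]

theorem fg_RiDual [IsNoetherianRing R] (i : ℕ) : (RiDual R K i).FG :=
  fg_dual (coeSubmodule_ne_bot (Ri_ne_bot i))

variable [IsDomain R]

theorem exists_isLeast_values {A : Submodule R K} (hA : A ≠ ⊥) :
    ∃ i, IsLeast (values K A) (s R K i) := by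
  obtain ⟨a, ha, haA⟩ := exists_ne_zero_algebraMap_mem hA
  obtain ⟨e, he⟩ := ENat.ne_top_iff_exists.1 (mt (val_eq_top_iff (K := K)).1 ha)
  have hne : (values K A).Nonempty := ⟨e, a, haA, he.symm⟩
  obtain ⟨x, -, hx⟩ := Nat.sInf_mem hne
  obtain ⟨i, hi⟩ := range_s.ge (mem_values_one.2 ⟨x, hx⟩)
  exact ⟨i, hi ▸ isLeast_csInf hne⟩

variable [IsNoetherianRing R]

theorem sum_r_eq_len (hdim : ringKrullDim R = 1) (k : ℕ) :
    ∑ i ∈ Finset.Icc 1 k, r R K i = len (RiDual R K k) 1 := by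
  induction k with
  | zero => simp [RiDual_zero, len_self]
  | succ k ih =>
    rw [Finset.sum_Icc_succ_top (Nat.le_add_left 1 k), ih, r, Nat.add_sub_cancel, add_comm]
    exact len_add_len_of_fg hdim (fg_RiDual _) one_ne_zero (one_le_RiDual k)
      (RiDual_mono k.le_succ)

theorem len_one_coeSubmodule_Ri (hdim : ringKrullDim R = 1) (hres : IsResiduallyRational R K)
    (i : ℕ) : len (1 : Submodule R K) (coeSubmodule K (Ri R K i)) = i := by
  induction i with
  | zero => rw [Ri_zero, coeSubmodule_top, len_self]
  | succ i ih =>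
    have hone : len (coeSubmodule K (Ri R K i)) (coeSubmodule K (Ri R K (i + 1))) = 1 :=
      (len_map_map (IsFractionRing.injective R K) _ _).trans
        (len_eq_one_of_covBy (Ri_succ_covBy hres i))
    rw [← len_add_len_of_fg hdim fg_one (coeSubmodule_ne_bot (Ri_ne_bot _))
      (coeSubmodule_mono K (Ri_antitone i.le_succ)) (coeSubmodule_le_one _), ih, hone]

end FractionField

section Conductor

variable {R K : Type*} [CommRing R] [Field K] [Algebra R K]

theorem conductor_le_one : conductor R K ≤ 1 := dual_le_one one_le_Rbar

variable [IsDomain R] [IsFractionRing R K] [Module.Finite R (integralClosure R K)]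

theorem c_eq_delta_add_n [IsNoetherianRing R] (hdim : ringKrullDim R = 1) :
    c R K = delta R K + n R K :=
  (len_add_len_of_fg hdim fg_Rbar (dual_ne_bot fg_Rbar) conductor_le_one one_le_Rbar).symm

variable [IsDiscreteValuationRing (integralClosure R K)]

theorem exists_conductor_eq_smul_Rbar :
    ∃ g : R, g ≠ 0 ∧ conductor R K = algebraMap R K g • Rbar R K := by
  set J : Ideal R := (conductor R K).comap (Algebra.linearMap R K)
  have hJK : coeSubmodule K J = conductor R K :=
    Submodule.map_comap_eq_self (conductor_le_one.trans_eq Submodule.one_eq_range)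
  obtain ⟨g, hgJ, hg, hle⟩ := exists_coeSubmodule_le_smul_Rbar (I := J) (K := K) (by
    intro h
    exact dual_ne_bot fg_Rbar (hJK.symm.trans (h ▸ coeSubmodule_bot K)))
  refine ⟨g, hg, (hJK.ge.trans hle).antisymm ?_⟩
  rintro _ ⟨w, hw, rfl⟩
  refine mem_dual.2 fun y hy => ?_
  have hwy : w * y ∈ Rbar R K := Rbar_mul_Rbar.le (Submodule.mul_mem_mul hw hy)
  change algebraMap R K g * w * y ∈ 1
  exact (mul_assoc _ w y).symm ▸ mem_dual.1 hgJ _ hwy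

theorem dual_conductor : dual K (conductor R K) = Rbar R K := by
  obtain ⟨g, hg, hcond⟩ := exists_conductor_eq_smul_Rbar (R := R) (K := K)
  have hgK : algebraMap R K g ≠ 0 := by simpa using hg
  rw [hcond]
  exact MulAction.injective₀ hgK ((smul_dual_smul hgK _).trans hcond)

theorem dual_dual_le_Rbar {A : Submodule R K} (hA : A ≤ Rbar R K) : dual K (dual K A) ≤ Rbar R K :=
  (dual_antitone (dual_antitone hA)).trans_eq dual_conductor

theorem exists_coeSubmodule_Ri_eq_conductor :
    ∃ j, coeSubmodule K (Ri R K j) = conductor R K := by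
  obtain ⟨g, hg, hcond⟩ := exists_conductor_eq_smul_Rbar (R := R) (K := K)
  obtain ⟨j, hj⟩ := exists_s_eq_val (K := K) hg
  refine ⟨j, le_antisymm ?_ fun x hx => ?_⟩
  · rintro _ ⟨x, hx, rfl⟩
    exact hcond ▸ val_le_val_iff.1 (hj ▸ mem_Ri.1 hx)
  · obtain ⟨x, rfl⟩ := Submodule.mem_one.1 (conductor_le_one hx)
    exact ⟨x, mem_Ri.2 (hj ▸ val_le_val_iff.2 (hcond ▸ hx)), rfl⟩

theorem RiDual_n_eq_Rbar [IsNoetherianRing R] (hdim : ringKrullDim R = 1)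
    (hres : IsResiduallyRational R K) : RiDual R K (n R K) = Rbar R K := by
  obtain ⟨j, hj⟩ := exists_coeSubmodule_Ri_eq_conductor (R := R) (K := K)
  rw [n, ← hj, len_one_coeSubmodule_Ri hdim hres, RiDual, hj, dual_conductor]

end Conductor

section BirationalExtension

variable {R K : Type*} [CommRing R] [IsDomain R] [IsNoetherianRing R] [Field K] [Algebra R K]
  [IsFractionRing R K] {A : Submodule R K}

theorem len_dual_dual_add_len (hdim : ringKrullDim R = 1) (hA : A.FG) (h1 : 1 ≤ A) :
    len (dual K (dual K A)) A + len A 1 = len (dual K (dual K A)) 1 :=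
  len_add_len_of_fg hdim (fg_dual (dual_ne_bot hA)) one_ne_zero h1 (le_dual_dual A)

variable [IsDiscreteValuationRing (integralClosure R K)]

theorem len_le_r_one_mul [IsLocalRing R] (hdim : ringKrullDim R = 1) (hA : A.FG) (h1 : 1 ≤ A) :
    len A 1 ≤ r R K 1 * len 1 (dual K A) :=
  calc len A 1
    _ ≤ len (dual K (dual K A)) 1 := len_dual_dual_add_len hdim hA h1 ▸ Nat.le_add_left _ _
    _ ≤ r R K 1 * len 1 (dual K A) := by
      have h := len_dual_le hdim fg_one (dual_ne_bot hA) (dual_le_one h1)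
      rwa [dual_one, ← r_one] at h

theorem len_dual_dual_add_len_eq_sum_r (hdim : ringKrullDim R = 1) (hA : A.FG) (h1 : 1 ≤ A) {i : ℕ}
    (hi : s R K i ∈ lowerBounds (values K (dual K A))) :
    len (dual K (dual K A)) A + len A 1 =
      len (dual K (dual K A)) (RiDual R K i) + ∑ j ∈ Finset.Icc 1 i, r R K j := by
  rw [len_dual_dual_add_len hdim hA h1, sum_r_eq_len hdim]
  exact (len_add_len_of_fg hdim (fg_dual (dual_ne_bot hA)) one_ne_zero (one_le_RiDual i)
    (RiDual_le_dual (dual_le_one h1) hi)).symm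

variable [Module.Finite R (integralClosure R K)]

theorem sum_r_eq_len_add_len_add_len (hdim : ringKrullDim R = 1)
    (hres : IsResiduallyRational R K) (h1 : 1 ≤ A) (hA : A ≤ Rbar R K) :
    ∑ i ∈ Finset.Icc 1 (n R K), r R K i =
      len (Rbar R K) (dual K (dual K A)) + (len (dual K (dual K A)) A + len A 1) := by
  rw [sum_r_eq_len hdim, RiDual_n_eq_Rbar hdim hres,
    len_dual_dual_add_len hdim (fg_Rbar.of_le hA) h1]
  exact (len_add_len_of_fg hdim fg_Rbar one_ne_zero (h1.trans (le_dual_dual A))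
    (dual_dual_le_Rbar hA)).symm

theorem len_blowup_eq_sum_sdiff_Gam (hdim : ringKrullDim R = 1) (hres : IsResiduallyRational R K)
    {I : Ideal R} (hI : I ≠ ⊥) :
    (len (blowup K I) 1 : ℤ) = ∑ i ∈ Finset.Icc 1 (n R K) \ Gam K I, (r R K i : ℤ)
      - len (dual K (dual K (blowup K I))) (blowup K I) - d K I := by
  have hGam : Gam K I ⊆ Finset.Icc 1 (n R K) := by
    classical exact Finset.filter_subset _ _
  have hsum := sum_r_eq_len_add_len_add_len hdim hres (one_le_blowup I) (blowup_le_Rbar (K := K) hI)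
  rw [Finset.sum_sdiff_eq_sub hGam, d, ← Nat.cast_sum, hsum]
  push_cast
  ring

end BirationalExtension

theorem ne_bot_of_radical_eq_maximalIdeal {R : Type*} [CommRing R] [IsDomain R] [IsLocalRing R]
    (hdim : ringKrullDim R = 1) {I : Ideal R} (hI : I.radical = maximalIdeal R) :
    I ≠ ⊥ := by
  rintro rfl
  exact maximalIdeal_ne_bot hdim (hI.symm.trans Ideal.isRadical_bot.radical)

end Blowup

open Blowup in
theorem theorem4p4_general {R K : Type*} [CommRing R] [IsDomain R] [IsLocalRing R]
    [IsNoetherianRing R] [Field K] [Algebra R K] [IsFractionRing R K]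
    (hdim : ringKrullDim R = 1)
    [Module.Finite R (integralClosure R K)] [IsDiscreteValuationRing (integralClosure R K)]
    (hres : IsResiduallyRational R K) {I : Ideal R} (hI : I ≠ ⊥) :
    ∃ (h : ℤ[X]) (ρ : ℤ),
      IsHPolynomial I h ∧ ρ = (derivative h).eval 1 ∧
      ρ = len (blowup K I) 1 ∧
      ρ = ∑ i ∈ Finset.Icc 1 (n R K) \ Gam K I, (r R K i : ℤ)
          - len (dual K (dual K (blowup K I))) (blowup K I) - d K I ∧
      ρ ≤ (r R K 1 : ℤ) * len 1 (dual K (blowup K I)) ∧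
      (blowup K I = Rbar R K →
        ρ = delta R K ∧
        (len 1 (dual K (blowup K I)) : ℤ) = (c R K : ℤ) - delta R K ∧
        (delta R K : ℤ) ≤ (r R K 1 : ℤ) * ((c R K : ℤ) - delta R K)) ∧
      (∃ i₀ : ℕ, IsLeast (values K (dual K (blowup K I))) (s R K i₀)) ∧
      ∀ i₀ : ℕ, IsLeast (values K (dual K (blowup K I))) (s R K i₀) →
        ρ = ∑ i ∈ Finset.Icc 1 i₀, (r R K i : ℤ)
            - len (dual K (dual K (blowup K I))) (blowup K I)
            + len (dual K (dual K (blowup K I))) (RiDual R K i₀) := by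
  obtain ⟨h, hh, hgenus⟩ := exists_isHPolynomial_derivative_eq_len_blowup (K := K) hdim hI
  have h1 : 1 ≤ blowup K I := one_le_blowup I
  have hfg : (blowup K I).FG := fg_Rbar.of_le (blowup_le_Rbar hI)
  refine ⟨h, len (blowup K I) 1, hh, hgenus.symm, rfl, len_blowup_eq_sum_sdiff_Gam hdim hres hI,
    mod_cast len_le_r_one_mul hdim hfg h1, fun hΛ => ?_,
    exists_isLeast_values (dual_ne_bot hfg), fun i₀ hi₀ => ?_⟩
  · have hn : (n R K : ℤ) = c R K - delta R K := by
      rw [c_eq_delta_add_n hdim]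
      push_cast
      ring
    rw [hΛ, ← hn]
    exact ⟨rfl, rfl, mod_cast len_le_r_one_mul hdim fg_Rbar one_le_Rbar⟩
  · have hsum := len_dual_dual_add_len_eq_sum_r hdim hfg h1 hi₀.2
    zify at hsum
    linarith

theorem theorem4p4 {R K : Type*} [CommRing R] [IsDomain R] [IsLocalRing R] [IsNoetherianRing R]
    [Field K] [Algebra R K] [IsFractionRing R K]
    (hdim : ringKrullDim R = 1)
    [Infinite (IsLocalRing.ResidueField R)]
    -- analytically irreducible: the integral closure is finite over `R` and a DVR
    [Module.Finite R (integralClosure R K)]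
    [IsDiscreteValuationRing (integralClosure R K)]
    -- residually rational: `R` and its integral closure have the same residue field
    (hres : Function.Surjective
      ((IsLocalRing.residue (integralClosure R K)).comp (algebraMap R (integralClosure R K))))
    -- `I` is primary to the maximal ideal and not principal
    (I : Ideal R) (hI : I.radical = IsLocalRing.maximalIdeal R)
    (hnp : ¬ Submodule.IsPrincipal I) :
    ∃ (h : ℤ[X]) (ρ : ℤ),
      -- `ρ` is the genus of `I`
      Blowup.IsHPolynomial I h ∧ ρ = (derivative h).eval 1 ∧
      ρ = Blowup.len (Blowup.blowup K I) 1 ∧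
      -- the first formula and the bound
      ρ = ∑ i ∈ Finset.Icc 1 (Blowup.n R K) \ Blowup.Gam K I, (Blowup.r R K i : ℤ)
          - Blowup.len (Blowup.dual K (Blowup.dual K (Blowup.blowup K I))) (Blowup.blowup K I)
          - Blowup.d K I ∧
      ρ ≤ (Blowup.r R K 1 : ℤ) * Blowup.len 1 (Blowup.dual K (Blowup.blowup K I)) ∧
      -- for `Λ = R̄` the bound is that of Matlis
      (Blowup.blowup K I = Blowup.Rbar R K →
        ρ = Blowup.delta R K ∧
        (Blowup.len 1 (Blowup.dual K (Blowup.blowup K I)) : ℤ)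
          = (Blowup.c R K : ℤ) - Blowup.delta R K ∧
        (Blowup.delta R K : ℤ)
          ≤ (Blowup.r R K 1 : ℤ) * ((Blowup.c R K : ℤ) - Blowup.delta R K)) ∧
      -- the second formula, where `s_{i₀}` is the smallest value of `R : Λ`
      (∃ i₀ : ℕ,
        IsLeast (Blowup.values K (Blowup.dual K (Blowup.blowup K I))) (Blowup.s R K i₀)) ∧
      ∀ i₀ : ℕ,
        IsLeast (Blowup.values K (Blowup.dual K (Blowup.blowup K I))) (Blowup.s R K i₀) →
        ρ = ∑ i ∈ Finset.Icc 1 i₀, (Blowup.r R K i : ℤ)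
            - Blowup.len (Blowup.dual K (Blowup.dual K (Blowup.blowup K I))) (Blowup.blowup K I)
            + Blowup.len (Blowup.dual K (Blowup.dual K (Blowup.blowup K I)))
                (Blowup.RiDual R K i₀) := by
  exact theorem4p4_general hdim hres (Blowup.ne_bot_of_radical_eq_maximalIdeal hdim hI)
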